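/- Let $\mathbb H$ be the space of quaternions with its Euclidean inner product $g$, let $\Gamma\subset\mathbb H$ be a lattice (a discrete subgroup spanning $\mathbb H$ over $\mathbb R$), and let $M=\mathbb H/\Gamma$ be the quotient torus of real dimension $4$, with projection $p:\mathbb H\to M$ and with all tangent spaces identified with $\mathbb H$ by translations. Let $\omega(u,v)=g(ui,v)$ and $$\hat\omega_I(u,v)=g(iu,v),\qquad \hat\omega_J(u,v)=g(ju,v),\qquad \hat\omega_K(u,v)=g(ku,v),$$ let $\omega_M$ be the symplectic form on $M$ induced by $\omega$, and put $\sigma=\tfrac12\,\omega\wedge\omega$. A Euclidean simplex of $M$ is the image $\sigma_0=p(\tilde\sigma)$ of the convex hull $\tilde\sigma\subset\mathbb H$ of finitely many affinely independent points such that $p|_{\tilde\sigma}$ is injective; its faces are the images of the faces of $\tilde\sigma$. A Euclidean triangulation $\mathscr T$ of $M$ is a finite set of Euclidean simplices covering $M$, closed under taking faces, such that any two simplices that meet intersect in a common face. Let $M'$ be the complement of its $3$-skeleton (the union of the simplices of dimension at most $3$). A continuous map $f:M\to M$ is polyhedral (with respect to $\mathscr T$) if for every simplex $p(\tilde\sigma)$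 of $\mathscr T$ there is an affine map $A:\mathbb H\to\mathbb H$ with $f\circ p=p\circ A$ on $\tilde\sigma$. On $M'$ such a map has a locally constant differential $\mathscr Df$ with values in $\mathrm{End}_{\mathbb R}(\mathbb H)$ (the linear parts of these affine maps). It is called a symplectic polyhedral map if moreover $f^*\omega_M=\omega_M$ on $M'$. The hyperKähler moment map is $\boldsymbol\mu=(\mu_I,\mu_J,\mu_K)$, where $$\mu_\bullet(F)=-\frac{F^*\omega\wedge\hat\omega_\bullet}{\sigma}\qquad(\bullet=I,J,K)$$ is a function on $M'$ for every locally constant $F:M'\to\mathrm{End}_{\mathbb R}(\mathbb H)$. Let $f:M\to M$ be a polyhedral map with respect to $\mathscr T$ such that $f^*[\omega_M]=[\omega_M]$ in the de Rham cohomology $H^2(M,\mathbb R)$, where $f^*$ is the map induced in cohomology by the continuous map $f$ (that is, by any smooth map homotopic to $f$). If $\boldsymbol\mu(\mathscr Df)=0$ on $M'$, then $f^*\omega_M=\omega_M$ on $M'$; that is, $f$ is a symplectic polyhedral map. -/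

import Mathlib

open scoped Quaternion Topology ContDiff RealInnerProductSpace

noncomputable section

namespace PolyTorus

/-! ### The flat hyperkähler structure of the quaternions -/

/-- Multiplication by the quaternion `q` on the left, as a real linear map. -/
def leftMul (q : ℍ) : ℍ →L[ℝ] ℍ := ContinuousLinearMap.mul ℝ ℍ q

/-- Multiplication by the quaternion `q` on the right, as a real linear map. -/
def rightMul (q : ℍ) : ℍ →L[ℝ] ℍ := (ContinuousLinearMap.mul ℝ ℍ).flip q

def qi : ℍ := ⟨0, 1, 0, 0⟩
def qj : ℍ := ⟨0, 0, 1, 0⟩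
def qk : ℍ := ⟨0, 0, 0, 1⟩

theorem inner_leftMul_self (q : ℍ) (hq : q.re = 0) (v : ℍ) : ⟪leftMul q v, v⟫ = 0 := by
  simp only [leftMul, ContinuousLinearMap.mul_apply', Quaternion.inner_def, Quaternion.re_mul,
    Quaternion.imI_mul, Quaternion.imJ_mul, Quaternion.imK_mul, Quaternion.re_star,
    Quaternion.imI_star, Quaternion.imJ_star, Quaternion.imK_star, hq]
  ring

theorem inner_rightMul_self (q : ℍ) (hq : q.re = 0) (v : ℍ) : ⟪rightMul q v, v⟫ = 0 := by
  simp only [rightMul, ContinuousLinearMap.flip_apply, ContinuousLinearMap.mul_apply',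
    Quaternion.inner_def, Quaternion.re_mul,
    Quaternion.imI_mul, Quaternion.imJ_mul, Quaternion.imK_mul, Quaternion.re_star,
    Quaternion.imI_star, Quaternion.imJ_star, Quaternion.imK_star, hq]
  ring

/-- The alternating form `(u, v) ↦ g(A u, v)` of a skew-symmetric endomorphism `A`. -/
def kahlerForm (A : ℍ →L[ℝ] ℍ) (hA : ∀ v, ⟪A v, v⟫ = 0) : ℍ [⋀^Fin 2]→L[ℝ] ℝ where
  toFun v := ⟪A (v 0), v 1⟫
  map_update_add' v i x y := by
    fin_cases i <;> simp [Function.update, inner_add_left, inner_add_right]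
  map_update_smul' v i c x := by
    fin_cases i <;> simp [Function.update, inner_smul_left, inner_smul_right]
  cont := by fun_prop
  map_eq_zero_of_eq' v i j h hij := by
    have h01 : v 0 = v 1 := by
      fin_cases i <;> fin_cases j <;> simp_all
    simp [h01, hA]

/-- `ω_V = g(i ·, ·)`, where the complex structure `i` is the quaternionic multiplication by `i`
on the right. -/
def omegaV : ℍ [⋀^Fin 2]→L[ℝ] ℝ := kahlerForm (rightMul qi) (inner_rightMul_self qi rfl)

/-- `ω̂_I = g(I ·, ·)`, where `I` is the quaternionic multiplication by `i` on the left. -/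
def omegaI : ℍ [⋀^Fin 2]→L[ℝ] ℝ := kahlerForm (leftMul qi) (inner_leftMul_self qi rfl)

/-- `ω̂_J = g(J ·, ·)`, where `J` is the quaternionic multiplication by `j` on the left. -/
def omegaJ : ℍ [⋀^Fin 2]→L[ℝ] ℝ := kahlerForm (leftMul qj) (inner_leftMul_self qj rfl)

/-- `ω̂_K = g(K ·, ·)`, where `K` is the quaternionic multiplication by `k` on the left. -/
def omegaK : ℍ [⋀^Fin 2]→L[ℝ] ℝ := kahlerForm (leftMul qk) (inner_leftMul_self qk rfl)

/-- The wedge product of two `2`-forms, as the sum over `(2,2)`-shuffles, evaluated on four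
vectors. -/
def wedge (a b : ℍ [⋀^Fin 2]→L[ℝ] ℝ) (v : Fin 4 → ℍ) : ℝ :=
  a ![v 0, v 1] * b ![v 2, v 3] - a ![v 0, v 2] * b ![v 1, v 3]
    + a ![v 0, v 3] * b ![v 1, v 2] + a ![v 1, v 2] * b ![v 0, v 3]
    - a ![v 1, v 3] * b ![v 0, v 2] + a ![v 2, v 3] * b ![v 0, v 1]

/-- The volume form `σ = ω_V ∧ ω_V / 2`. -/
def sigmaV (v : Fin 4 → ℍ) : ℝ := wedge omegaV omegaV v / 2

/-- The moment map density `-(F^*ω_V ∧ ω̂) / σ` at a point where the `ℍ`-valued `1`-form is `F`.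
The quotient of the two `4`-forms is computed on the frame `1, i, j, k`. -/
def moment (omegaHat : ℍ [⋀^Fin 2]→L[ℝ] ℝ) (F : ℍ →L[ℝ] ℍ) : ℝ :=
  -(wedge (omegaV.compContinuousLinearMap F) omegaHat ![1, qi, qj, qk]
      / sigmaV ![1, qi, qj, qk])

/-- The hyperkähler moment map `𝛍 = (μ_I, μ_J, μ_K)`, at one point. -/
def hyperMoment (F : ℍ →L[ℝ] ℍ) : ℝ × ℝ × ℝ :=
  (moment omegaI F, moment omegaJ F, moment omegaK F)

/-! ### The torus, its differential forms and maps -/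

/-- The torus `M = V / Γ`. -/
abbrev Torus (Γ : Submodule ℤ ℍ) : Type := ℍ ⧸ Γ.toAddSubgroup

variable (Γ : Submodule ℤ ℍ)

/-- The projection `p : V → M`. -/
def proj (x : ℍ) : Torus Γ := QuotientAddGroup.mk x

/-- `k`-forms on `M`, with the tangent spaces of `M` identified with `ℍ` by translations. -/
abbrev TorusForm (k : ℕ) : Type := Torus Γ → ℍ [⋀^Fin k]→L[ℝ] ℝ

/-- A `k`-form on `M` is smooth if its pullback to `V` is. -/
def IsSmoothForm {k : ℕ} (η : TorusForm Γ k) : Prop := ContDiff ℝ ∞ (fun x => η (proj Γ x))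

/-- `[α] = [β]` in de Rham cohomology: `α - β = dη` for some smooth form `η` on `M`. -/
def Cohomologous {k : ℕ} (α β : TorusForm Γ (k + 1)) : Prop :=
  ∃ η : TorusForm Γ k, IsSmoothForm Γ η ∧
    ∀ x : ℍ, α (proj Γ x) - β (proj Γ x) = extDeriv (fun y => η (proj Γ y)) x

/-- The tangent map of `f : M → M` at `x` is `L : ℍ → ℍ`: some local lift `g` of `f` to `V`
has derivative `L` at a point above `x`. -/
def HasTorusDerivAt (f : Torus Γ → Torus Γ) (x : Torus Γ) (L : ℍ →L[ℝ] ℍ) : Prop :=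
  ∃ (x' : ℍ) (g : ℍ → ℍ), proj Γ x' = x ∧ (∀ᶠ y in 𝓝 x', proj Γ (g y) = f (proj Γ y)) ∧
    HasFDerivAt g L x'

open Classical in
/-- The differential `𝒟f`, an `ℍ`-valued `1`-form (with the value `0` at the points where `f`
is not differentiable). -/
def torusDeriv (f : Torus Γ → Torus Γ) (x : Torus Γ) : ℍ →L[ℝ] ℍ :=
  if h : ∃ L, HasTorusDerivAt Γ f x L then h.choose else 0

/-- The pullback `f^*α` of a form on `M`. -/
def pullback {k : ℕ} (f : Torus Γ → Torus Γ) (α : TorusForm Γ k) : TorusForm Γ k :=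
  fun x => (α (f x)).compContinuousLinearMap (torusDeriv Γ f x)

/-- The symplectic form `ω_M`. -/
def omegaM : TorusForm Γ 2 := fun _ => omegaV

/-- A map `M → M` is smooth if it has a smooth lift `V → V`. -/
def IsSmoothMap (g : Torus Γ → Torus Γ) : Prop :=
  ∃ g' : ℍ → ℍ, ContDiff ℝ ∞ g' ∧ ∀ x, g (proj Γ x) = proj Γ (g' x)

/-- `f^*[α] = [β]` in the de Rham cohomology of `M`, for a continuous map `f`. The map induced by
`f` in cohomology is the one induced by any smooth map homotopic to `f`. -/
def PullbackClassEq {k : ℕ} (f : C(Torus Γ, Torus Γ)) (α β : TorusForm Γ (k + 1)) : Prop :=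
  ∃ g : C(Torus Γ, Torus Γ), IsSmoothMap Γ g ∧ f.Homotopic g ∧
    Cohomologous Γ (pullback Γ g α) β

/-! ### Euclidean triangulations and polyhedral maps -/

/-- The convex hull of `s` is a Euclidean simplex of `V` that `p` maps bijectively to `σ`. (The map
is then a diffeomorphism, since `p` is a local isometry and a simplex is compact.) -/
def IsSimplexLift (s : Finset ℍ) (σ : Set (Torus Γ)) : Prop :=
  s.Nonempty ∧ AffineIndependent ℝ ((↑) : s → ℍ) ∧
    Set.BijOn (proj Γ) (convexHull ℝ (s : Set ℍ)) σ

/-- `σ` is a Euclidean `k`-simplex of `M`. -/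
def IsEuclideanSimplex (k : ℕ) (σ : Set (Torus Γ)) : Prop :=
  ∃ s : Finset ℍ, s.card = k + 1 ∧ IsSimplexLift Γ s σ

/-- `τ` is a face (possibly not proper) of the Euclidean simplex `σ`. -/
def IsFace (τ σ : Set (Torus Γ)) : Prop :=
  ∃ s : Finset ℍ, IsSimplexLift Γ s σ ∧ ∃ t ⊆ s, IsSimplexLift Γ t τ

/-- A Euclidean triangulation of `M`: a finite simplicial decomposition into Euclidean simplices. -/
structure EuclideanTriangulation where
  cells : Set (Set (Torus Γ))
  finite : cells.Finite
  simplex : ∀ σ ∈ cells, ∃ k, IsEuclideanSimplex Γ k σ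
  face_mem : ∀ σ ∈ cells, ∀ τ, IsFace Γ τ σ → τ ∈ cells
  inter_face : ∀ σ ∈ cells, ∀ τ ∈ cells, (σ ∩ τ).Nonempty →
    IsFace Γ (σ ∩ τ) σ ∧ IsFace Γ (σ ∩ τ) τ
  cover : ⋃₀ cells = Set.univ

variable {Γ}

/-- The `k`-skeleton: the union of the cells of dimension at most `k`. -/
def EuclideanTriangulation.skeleton (T : EuclideanTriangulation Γ) (k : ℕ) : Set (Torus Γ) :=
  ⋃₀ {σ ∈ T.cells | ∃ m ≤ k, IsEuclideanSimplex Γ m σ}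

/-- `f : M → M` is polyhedral: its restriction to every simplex has an affine lift to `V`. -/
def IsPolyhedral (T : EuclideanTriangulation Γ) (f : C(Torus Γ, Torus Γ)) : Prop :=
  ∀ σ ∈ T.cells, ∃ s : Finset ℍ, IsSimplexLift Γ s σ ∧
    ∃ A : ℍ →ᵃ[ℝ] ℍ, ∀ x ∈ convexHull ℝ (s : Set ℍ), f (proj Γ x) = proj Γ (A x)

/-- A symplectic polyhedral map: a polyhedral map with `f^*ω_M = ω_M` off the `3`-skeleton. -/
def IsSymplecticPolyhedral (T : EuclideanTriangulation Γ) (f : C(Torus Γ, Torus Γ)) : Prop :=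
  IsPolyhedral T f ∧ ∀ x ∉ T.skeleton 3, pullback Γ f (omegaM Γ) x = omegaM Γ x

end PolyTorus

end

/-! This is a calibration argument. Lift `f` to `F : ℍ → ℍ` with `F (x + γ) = F x + L γ` on `Γ`, and
write `A` for the derivative of `F` at a point over `M'`. The vanishing of the moment map says that
`A^*ω` wedges to zero with the three forms `ω̂`, so it lies in the complementary 3-dimensional space
of 2-forms, which contains `ω`. Let `a, b, c` be its values on `(1,i)`, `(1,j)`, `(1,k)`. The
Pfaffian formula then gives `det A = a² + b² + c²`, hence `det A - 2a + 1 = (a - 1)² + b² + c² ≥ 0`,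
with equality exactly when `A^*ω = ω`.

Both `det` and `a` are null Lagrangians: their integrals over a fundamental domain depend only on
`L` (`setIntegral_det_fderiv`, `setIntegral_omegaV_fderiv`). The cohomological hypothesis forces
`L^*ω = ω` (`omegaV_periods_of_cohomologous`), so `det L = 1` and the integral of the nonnegative
function above is `vol · (1 - 2 + 1) = 0`. Hence `A^*ω = ω` almost everywhere
(`ae_pullback_omegaV_eq`), and everywhere on `M'` because `A` is locally constant there. -/

noncomputable section

open MeasureTheory Set Filter

namespace PolyTorus

/-! ### The Jacobian determinant as a null Lagrangian, for Lipschitz maps with linear periods. -/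

section NullLagrangian

open scoped NNReal ENNReal

variable {E : Type*} [NormedAddCommGroup E] [NormedSpace ℝ E] [FiniteDimensional ℝ E]

theorem exists_homeomorph_smul_add {F : E → E} {K : ℝ≥0} (hF : LipschitzWith K F) {c : ℝ}
    (hc : K < c) : ∃ G : E ≃ₜ E, ∀ x, G x = c • x + F x := by
  have hc0 : 0 < c := K.2.trans_lt hc
  let e : E ≃L[ℝ] E := ContinuousLinearEquiv.smulLeft (Units.mk0 c hc0.ne')
  have happ : ApproximatesLinearOn (fun x => c • x + F x) (e : E →L[ℝ] E) univ K := by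
    rw [ApproximatesLinearOn.approximatesLinearOn_iff_lipschitzOnWith, lipschitzOnWith_univ]
    convert hF using 2 with x
    funext x
    simp [e, Units.smul_def]
  have hK : Subsingleton E ∨ K < ‖(e.symm : E →L[ℝ] E)‖₊⁻¹ := by
    rcases subsingleton_or_nontrivial E with h | h
    · exact .inl h
    · refine .inr ?_
      have h1 : (e.symm : E →L[ℝ] E) = c⁻¹ • ContinuousLinearMap.id ℝ E := by
        ext x
        change e.symm x = c⁻¹ • x
        rw [ContinuousLinearEquiv.symm_apply_eq]
        simp [e, Units.smul_def, smul_smul, hc0.ne']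
      rw [h1, nnnorm_smul, ← NNReal.coe_lt_coe]
      simpa [abs_of_pos hc0] using hc
  exact ⟨happ.toHomeomorph _ hK, fun x => rfl⟩

/-- The maps `c + tA`, `0 ≤ t ≤ 1`, are all invertible, so the determinant keeps the sign it has at
`t = 0`. -/
theorem det_smul_id_add_pos {A : E →L[ℝ] E} {c : ℝ} (hc : ‖A‖ < c) :
    0 < (c • ContinuousLinearMap.id ℝ E + A).det := by
  have hc0 : 0 < c := (norm_nonneg A).trans_lt hc
  have hne : ∀ t ∈ Icc (0 : ℝ) 1, (c • ContinuousLinearMap.id ℝ E + t • A).det ≠ 0 := by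
    intro t ht h0
    have hlip : LipschitzWith ‖t • A‖₊ (t • A) := (t • A).lipschitz
    have hlt : ‖t • A‖ < c := by
      rw [norm_smul, Real.norm_of_nonneg ht.1]
      nlinarith [norm_nonneg A, ht.2]
    obtain ⟨G, hG⟩ := exists_homeomorph_smul_add hlip hlt
    have hinj : Function.Injective (c • ContinuousLinearMap.id ℝ E + t • A) := by
      intro x y hxy
      apply G.injective
      rw [hG, hG]
      simpa using hxy
    have hk : LinearMap.ker
        ((c • ContinuousLinearMap.id ℝ E + t • A : E →L[ℝ] E) : E →ₗ[ℝ] E) = ⊥ :=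
      LinearMap.ker_eq_bot.2 hinj
    exact (LinearMap.bot_lt_ker_of_det_eq_zero h0).ne' hk
  have hcont : ContinuousOn (fun t : ℝ => (c • ContinuousLinearMap.id ℝ E + t • A).det)
      (Icc 0 1) :=
    (ContinuousLinearMap.continuous_det.comp (by fun_prop)).continuousOn
  have h0 : 0 < (c • ContinuousLinearMap.id ℝ E + (0 : ℝ) • A).det := by
    simp only [zero_smul, add_zero, ContinuousLinearMap.det, ContinuousLinearMap.toLinearMap_smul,
      ContinuousLinearMap.coe_id, LinearMap.det_smul, LinearMap.det_id]
    positivity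
  by_contra hneg
  obtain ⟨t, ht, hte⟩ := intermediate_value_Icc' (zero_le_one' ℝ) hcont
    (show (0 : ℝ) ∈ Icc _ _ from ⟨by simpa using hneg, h0.le⟩)
  exact hne t ht hte

/-- The determinant of a linear map is a fixed linear combination of the determinants of its shifts
by finitely many large scalars. -/
theorem exists_det_eq_sum_det_smul_id_add (c₀ : ℝ) : ∃ (N : ℕ) (c w : ℕ → ℝ), (∀ i, c₀ < c i) ∧
    ∀ A : E →L[ℝ] E, A.det
      = ∑ i ∈ Finset.range N, w i * (c i • ContinuousLinearMap.id ℝ E + A).det := by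
  let N := Module.finrank ℝ E + 1
  let c : ℕ → ℝ := fun i => c₀ + 1 + i
  refine ⟨N, c, fun i => (Lagrange.basis (Finset.range N) c i).eval 0,
    fun i => by
      have := Nat.cast_nonneg (α := ℝ) i
      simp only [c]; linarith, fun A => ?_⟩
  have hinj : Set.InjOn c (Finset.range N) := fun i _ j _ h => by simpa [c] using h
  -- `det (t + A)` is a polynomial in `t` of degree `finrank ℝ E`, so Lagrange interpolation at
  -- `finrank ℝ E + 1` nodes recovers its value at `0`.
  have hp : ∀ t : ℝ, (LinearMap.charpoly (-(A : E →ₗ[ℝ] E))).eval t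
      = (t • ContinuousLinearMap.id ℝ E + A).det := by
    intro t
    rw [LinearMap.eval_charpoly, ContinuousLinearMap.det]
    congr 1
    ext x
    simp [Algebra.algebraMap_eq_smul_one]
  have hdeg : (LinearMap.charpoly (-(A : E →ₗ[ℝ] E))).degree < (Finset.range N).card := by
    rw [Polynomial.degree_eq_natDegree (LinearMap.charpoly_monic _).ne_zero,
      LinearMap.charpoly_natDegree, Finset.card_range]
    exact_mod_cast Nat.lt_succ_self _
  have h := congrArg (Polynomial.eval 0) (Lagrange.eq_interpolate hinj hdeg)
  rw [hp, Lagrange.interpolate_apply, Polynomial.eval_finsetSum] at h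
  simp only [zero_smul, zero_add, Polynomial.eval_mul, Polynomial.eval_C, hp] at h
  rw [h]
  exact Finset.sum_congr rfl fun i _ => mul_comm _ _

variable [MeasurableSpace E] [BorelSpace E] (μ : Measure E)

theorem integrableOn_comp_fderiv {F : E → E} {K : ℝ≥0} (hF : LipschitzWith K F)
    {D : Set E} (hfin : μ D ≠ ⊤) {B : (E →L[ℝ] E) → ℝ} (hB : Continuous B) :
    IntegrableOn (fun x => B (fderiv ℝ F x)) D μ := by
  obtain ⟨C, hC⟩ := (isCompact_closedBall (0 : E →L[ℝ] E) K).exists_bound_of_continuousOn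
    hB.continuousOn
  refine IntegrableOn.of_bound hfin.lt_top
    (hB.measurable.comp (measurable_fderiv ℝ F)).aestronglyMeasurable C ?_
  refine Eventually.of_forall fun x => hC _ ?_
  simpa using norm_fderiv_le_of_lipschitz ℝ hF

variable [μ.IsAddHaarMeasure]

theorem measure_image_eq_zero_of_lipschitzWith {F : E → E} {K : ℝ≥0} (hF : LipschitzWith K F)
    {s : Set E} (hs : μ s = 0) : μ (F '' s) = 0 := by
  have h1 : μ ≪ Measure.hausdorffMeasure (Module.finrank ℝ E) :=
    Measure.absolutelyContinuous_isAddHaarMeasure _ _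
  have h2 : Measure.hausdorffMeasure (Module.finrank ℝ E) ≪ μ :=
    Measure.absolutelyContinuous_isAddHaarMeasure _ _
  apply h1
  have := hF.hausdorffMeasure_image_le (d := Module.finrank ℝ E) (by positivity) s
  rw [h2 hs, mul_zero] at this
  exact le_antisymm this zero_le

variable {Γ : Submodule ℤ E} [Countable Γ] {D : Set E}

/-- `H` commutes with the lattice translations, so `H '' D` is again a fundamental domain. The
Lipschitz bound ensures that `H` preserves null sets. -/
theorem measure_image_fundamentalDomain (hD : IsAddFundamentalDomain Γ D μ) (H : E ≃ₜ E)
    {K : ℝ≥0} (hH : LipschitzWith K H) (hper : ∀ x, ∀ γ ∈ Γ, H (x + γ) = H x + γ) :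
    μ (H '' D) = μ D := by
  have hq : Measure.QuasiMeasurePreserving H.symm μ μ := by
    refine ⟨H.symm.continuous.measurable, fun s hs => ?_⟩
    rw [show ⇑H.symm = ⇑H.symm.toMeasurableEquiv from rfl, MeasurableEquiv.map_apply]
    have := measure_image_eq_zero_of_lipschitzWith μ hH hs
    rwa [H.image_eq_preimage_symm] at this
  have hHD := hD.image_of_equiv H.toEquiv hq (Equiv.refl Γ) (fun g x => by
    simp only [Equiv.coe_refl, id, Submodule.vadd_def, vadd_eq_add, Homeomorph.coe_toEquiv]
    rw [add_comm, hper _ _ g.2, add_comm])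
  have : VAddInvariantMeasure Γ E μ := inferInstanceAs (VAddInvariantMeasure Γ.toAddSubgroup E μ)
  have : MeasurableConstVAdd Γ E := inferInstanceAs (MeasurableConstVAdd Γ.toAddSubgroup E)
  exact hHD.measure_eq hD

/-- For large `c` the map `G x = c x + F x` is a homeomorphism with positive Jacobian, so the
integral is the volume of `G '' D`. With `T = c + L`, the map `T⁻¹ ∘ G` commutes with `Γ`, so that
volume is `det T · μ D`. -/
theorem setIntegral_det_smul_id_add (hD : IsAddFundamentalDomain Γ D μ) (hfin : μ D ≠ ⊤)
    {F : E → E} {K : ℝ≥0} (hF : LipschitzWith K F) {L : E →L[ℝ] E}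
    (hL : ∀ x, ∀ γ ∈ Γ, F (x + γ) = F x + L γ) {c : ℝ} (hc : K < c) (hc' : ‖L‖ < c) :
    ∫ x in D, (c • ContinuousLinearMap.id ℝ E + fderiv ℝ F x).det ∂μ
      = μ.real D * (c • ContinuousLinearMap.id ℝ E + L).det := by
  obtain ⟨G, hG⟩ := exists_homeomorph_smul_add hF hc
  obtain ⟨P, hP⟩ := exists_homeomorph_smul_add L.lipschitz hc'
  set T : E →L[ℝ] E := c • ContinuousLinearMap.id ℝ E + L with hT
  have hPT : ⇑P = T := by ext x; simp [hP, hT]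
  have hTb : Function.Bijective (T : E →ₗ[ℝ] E) := by
    have := P.bijective
    rw [hPT] at this
    exact this
  let e : E ≃L[ℝ] E := (LinearEquiv.ofBijective (T : E →ₗ[ℝ] E) hTb).toContinuousLinearEquiv
  have he : ∀ x, e x = T x := fun x => rfl
  have hGlip : LipschitzWith (‖c‖₊ + K) G := by
    have : ⇑G = fun x => c • x + F x := funext hG
    rw [this]
    refine LipschitzWith.add ?_ hF
    exact lipschitzWith_smul (β := E) c
  have hvol : μ (G '' D) = ENNReal.ofReal T.det * μ D := by
    have hH := measure_image_fundamentalDomain μ hD (G.trans e.symm.toHomeomorph)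
      (K := ‖(e.symm : E →L[ℝ] E)‖₊ * (‖c‖₊ + K))
      (e.symm.lipschitz.comp hGlip) (fun x γ hγ => by
        simp only [Homeomorph.trans_apply, ContinuousLinearEquiv.coe_toHomeomorph]
        rw [ContinuousLinearEquiv.symm_apply_eq, e.map_add, ContinuousLinearEquiv.apply_symm_apply,
          hG, hG, hL x γ hγ, he, hT]
        simp
        abel)
    have himg : G '' D = T '' ((G.trans e.symm.toHomeomorph) '' D) := by
      rw [← image_comp]
      refine image_congr' fun x => ?_
      change _ = e (e.symm (G x))
      simp
    rw [himg, Measure.addHaar_image_continuousLinearMap, hH, abs_of_pos (det_smul_id_add_pos hc')]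
  have hdiff : ∀ᵐ x ∂μ, DifferentiableAt ℝ F x := hF.ae_differentiableAt
  have hGd : ∀ x, DifferentiableAt ℝ F x →
      HasFDerivAt G (c • ContinuousLinearMap.id ℝ E + fderiv ℝ F x) x := by
    intro x hx
    have : ⇑G = fun x => c • x + F x := funext hG
    rw [this]
    exact ((hasFDerivAt_id x).const_smul c).add hx.hasFDerivAt
  set S := {x | DifferentiableAt ℝ F x}
  have hSc : μ Sᶜ = 0 := hdiff
  have hDS : (D ∩ S : Set E) =ᵐ[μ] D := inter_ae_eq_left_of_ae_eq_univ (ae_eq_univ.2 hSc)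
  -- The change of variables needs differentiability at every point; the discarded null set has null
  -- image.
  have hvol2 : μ (G '' (D ∩ S)) = μ (G '' D) := by
    refine le_antisymm (measure_mono (image_mono inter_subset_left)) ?_
    calc μ (G '' D) ≤ μ (G '' (D ∩ S) ∪ G '' Sᶜ) := measure_mono (by
          rw [← image_union]
          refine image_mono fun x hx => ?_
          by_cases h : x ∈ S
          · exact .inl ⟨hx, h⟩
          · exact .inr h)
      _ ≤ μ (G '' (D ∩ S)) + μ (G '' Sᶜ) := measure_union_le _ _
      _ = _ := by rw [measure_image_eq_zero_of_lipschitzWith μ hGlip hSc, add_zero]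
  have hcv := lintegral_abs_det_fderiv_eq_addHaar_image₀ μ
    (hD.nullMeasurableSet.inter (measurableSet_of_differentiableAt ℝ F).nullMeasurableSet)
    (f := G) (f' := fun x => c • ContinuousLinearMap.id ℝ E + fderiv ℝ F x)
    (fun x hx => (hGd x hx.2).hasFDerivWithinAt) G.injective.injOn
  have hpos : ∀ x, 0 < (c • ContinuousLinearMap.id ℝ E + fderiv ℝ F x).det := fun x =>
    det_smul_id_add_pos ((norm_fderiv_le_of_lipschitz ℝ hF).trans_lt hc)
  rw [setLIntegral_congr hDS, hvol2, hvol] at hcv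
  simp_rw [fun x => abs_of_pos (hpos x)] at hcv
  rw [integral_eq_lintegral_of_nonneg_ae (Eventually.of_forall fun x => (hpos x).le), hcv]
  · rw [ENNReal.toReal_mul, ENNReal.toReal_ofReal (det_smul_id_add_pos hc').le, mul_comm,
      Measure.real]
  · exact (integrableOn_comp_fderiv μ hF hfin
      (B := fun A => (c • ContinuousLinearMap.id ℝ E + A).det)
      (ContinuousLinearMap.continuous_det.comp (by fun_prop))).aestronglyMeasurable

/-- The Jacobian determinant is a null Lagrangian: its integral over a period depends only on the
periods of the map. -/
theorem setIntegral_det_fderiv (hD : IsAddFundamentalDomain Γ D μ) (hfin : μ D ≠ ⊤)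
    {F : E → E} {K : ℝ≥0} (hF : LipschitzWith K F) {L : E →L[ℝ] E}
    (hL : ∀ x, ∀ γ ∈ Γ, F (x + γ) = F x + L γ) :
    ∫ x in D, (fderiv ℝ F x).det ∂μ = μ.real D * L.det := by
  -- Shifts beyond both `K` and `‖L‖` make the shifts of `F` and of `L` invertible.
  obtain ⟨N, c, w, hc, hw⟩ := exists_det_eq_sum_det_smul_id_add (E := E) (max K ‖L‖)
  rw [hw L, integral_congr_ae (Eventually.of_forall fun x => hw (fderiv ℝ F x))]
  rw [integral_finsetSum]
  · rw [Finset.mul_sum]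
    refine Finset.sum_congr rfl fun i _ => ?_
    rw [integral_const_mul, setIntegral_det_smul_id_add μ hD hfin hF hL
      ((le_max_left _ _).trans_lt (hc i)) ((le_max_right _ _).trans_lt (hc i))]
    ring
  · intro i _
    exact (integrableOn_comp_fderiv μ hF hfin
      (B := fun A => (c i • ContinuousLinearMap.id ℝ E + A).det)
      (ContinuousLinearMap.continuous_det.comp (by fun_prop))).const_mul _

end NullLagrangian

/-! ### First derivatives and `2 × 2` minors as null Lagrangians. -/

section Minors

open scoped NNReal ENNReal

variable {E : Type*} [NormedAddCommGroup E] [NormedSpace ℝ E] [FiniteDimensional ℝ E]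

/-- A rank-two perturbation of the identity: `det (1 + PQ) = det (1 + QP)` reduces it to a `2 × 2`
determinant. -/
theorem det_id_add_smulRight_add_smulRight (a b : E →L[ℝ] ℝ) (u v : E) :
    (ContinuousLinearMap.id ℝ E + (a.smulRight u + b.smulRight v)).det
      = (1 + a u) * (1 + b v) - a v * b u := by
  classical
  let e := Module.finBasis ℝ E
  let P : Matrix (Fin (Module.finrank ℝ E)) (Fin 2) ℝ :=
    .of fun i => ![e.repr u i, e.repr v i]
  let Q : Matrix (Fin 2) (Fin (Module.finrank ℝ E)) ℝ :=
    .of ![fun j => a (e j), fun j => b (e j)]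
  have hM : LinearMap.toMatrix e e ((ContinuousLinearMap.id ℝ E +
      (a.smulRight u + b.smulRight v) : E →L[ℝ] E) : E →ₗ[ℝ] E) = 1 + P * Q := by
    ext i j
    simp [LinearMap.toMatrix_apply, Matrix.mul_apply, P, Q, Fin.sum_univ_two, Matrix.one_apply,
      Finsupp.single_apply, eq_comm, mul_comm]
  have hsum : ∀ (c : E →L[ℝ] ℝ) (w : E), ∑ j, c (e j) * e.repr w j = c w := by
    intro c w
    conv_rhs => rw [← e.sum_repr w, map_sum]
    simp [mul_comm]
  rw [ContinuousLinearMap.det, ← LinearMap.det_toMatrix e, hM, Matrix.det_one_add_mul_comm,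
    Matrix.det_fin_two]
  simp only [Matrix.add_apply, Matrix.mul_apply, Matrix.one_apply, P, Q, Matrix.of_apply]
  simp [hsum]

variable [MeasurableSpace E] [BorelSpace E] (μ : Measure E)

theorem integrableOn_comp_fderiv_fderiv {f g : E → ℝ} {Kf Kg : ℝ≥0}
    (hf : LipschitzWith Kf f) (hg : LipschitzWith Kg g)
    {D : Set E} (hfin : μ D ≠ ⊤) {B : (E →L[ℝ] ℝ) × (E →L[ℝ] ℝ) → ℝ} (hB : Continuous B) :
    IntegrableOn (fun x => B (fderiv ℝ f x, fderiv ℝ g x)) D μ := by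
  obtain ⟨C, hC⟩ := ((isCompact_closedBall (0 : E →L[ℝ] ℝ) Kf).prod
    (isCompact_closedBall (0 : E →L[ℝ] ℝ) Kg)).exists_bound_of_continuousOn hB.continuousOn
  refine IntegrableOn.of_bound hfin.lt_top (hB.measurable.comp
    ((measurable_fderiv ℝ f).prodMk (measurable_fderiv ℝ g))).aestronglyMeasurable C ?_
  refine Eventually.of_forall fun x => hC _ ⟨?_, ?_⟩
  · simpa using norm_fderiv_le_of_lipschitz ℝ hf
  · simpa using norm_fderiv_le_of_lipschitz ℝ hg

variable [μ.IsAddHaarMeasure] {Γ : Submodule ℤ E} [Countable Γ] {D : Set E}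

/-- This is `setIntegral_det_fderiv` for the map `x ↦ x + f x • u + g x • v`. -/
theorem setIntegral_one_add_mul_one_add_sub (hD : IsAddFundamentalDomain Γ D μ) (hfin : μ D ≠ ⊤)
    {f g : E → ℝ} {Kf Kg : ℝ≥0} (hf : LipschitzWith Kf f) (hg : LipschitzWith Kg g)
    {l m : E →L[ℝ] ℝ} (hl : ∀ x, ∀ γ ∈ Γ, f (x + γ) = f x + l γ)
    (hm : ∀ x, ∀ γ ∈ Γ, g (x + γ) = g x + m γ) (u v : E) :
    ∫ x in D, ((1 + fderiv ℝ f x u) * (1 + fderiv ℝ g x v)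
        - fderiv ℝ f x v * fderiv ℝ g x u) ∂μ
      = μ.real D * ((1 + l u) * (1 + m v) - l v * m u) := by
  have hsm : ∀ w : E, LipschitzWith ‖w‖₊ (fun t : ℝ => t • w) := fun w =>
    LipschitzWith.of_dist_le_mul fun s t => by
      rw [dist_eq_norm, dist_eq_norm, ← sub_smul, norm_smul, mul_comm, coe_nnnorm]
  have hG : LipschitzWith (1 + (‖u‖₊ * Kf + ‖v‖₊ * Kg)) (fun x => x + (f x • u + g x • v)) :=
    LipschitzWith.id.add (((hsm u).comp hf).add ((hsm v).comp hg))
  have key := setIntegral_det_fderiv μ hD hfin hG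
    (L := ContinuousLinearMap.id ℝ E + (l.smulRight u + m.smulRight v)) (fun x γ hγ => by
      simp [hl x γ hγ, hm x γ hγ, add_smul]
      abel)
  rw [det_id_add_smulRight_add_smulRight] at key
  rw [← key]
  refine integral_congr_ae (ae_restrict_of_ae ?_)
  filter_upwards [hf.ae_differentiableAt (μ := μ), hg.ae_differentiableAt (μ := μ)] with x hfx hgx
  rw [← det_id_add_smulRight_add_smulRight]
  congr 1
  exact (((hasFDerivAt_id x).add ((hfx.hasFDerivAt.smul_const u).add
    (hgx.hasFDerivAt.smul_const v))).fderiv).symm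

theorem setIntegral_fderiv_apply (hD : IsAddFundamentalDomain Γ D μ) (hfin : μ D ≠ ⊤)
    {f : E → ℝ} {K : ℝ≥0} (hf : LipschitzWith K f) {l : E →L[ℝ] ℝ}
    (hl : ∀ x, ∀ γ ∈ Γ, f (x + γ) = f x + l γ) (u : E) :
    ∫ x in D, fderiv ℝ f x u ∂μ = μ.real D * l u := by
  -- With second vector `0`, only the term linear in `f` survives.
  have key := setIntegral_one_add_mul_one_add_sub μ hD hfin hf hf hl hl u 0
  have hi : IntegrableOn (fun x => fderiv ℝ f x u) D μ :=
    integrableOn_comp_fderiv_fderiv μ hf hf hfin (B := fun p => p.1 u) (by fun_prop)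
  simp only [map_zero, add_zero, mul_one, zero_mul, sub_zero] at key
  have i0 : IntegrableOn (fun _ : E => (1 : ℝ)) D μ := integrableOn_const hfin
  rw [integral_add i0 hi, setIntegral_const, smul_eq_mul] at key
  linear_combination key

/-- The `2 × 2` minors of a Jacobian matrix are null Lagrangians. -/
theorem setIntegral_minor (hD : IsAddFundamentalDomain Γ D μ) (hfin : μ D ≠ ⊤)
    {f g : E → ℝ} {Kf Kg : ℝ≥0} (hf : LipschitzWith Kf f) (hg : LipschitzWith Kg g)
    {l m : E →L[ℝ] ℝ} (hl : ∀ x, ∀ γ ∈ Γ, f (x + γ) = f x + l γ)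
    (hm : ∀ x, ∀ γ ∈ Γ, g (x + γ) = g x + m γ) (u v : E) :
    ∫ x in D, (fderiv ℝ f x u * fderiv ℝ g x v - fderiv ℝ f x v * fderiv ℝ g x u) ∂μ
      = μ.real D * (l u * m v - l v * m u) := by
  have key := setIntegral_one_add_mul_one_add_sub μ hD hfin hf hg hl hm u v
  have h1 := setIntegral_fderiv_apply μ hD hfin hf hl u
  have h2 := setIntegral_fderiv_apply μ hD hfin hg hm v
  have i1 : IntegrableOn (fun x => fderiv ℝ f x u) D μ :=
    integrableOn_comp_fderiv_fderiv μ hf hg hfin (B := fun p => p.1 u) (by fun_prop)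
  have i2 : IntegrableOn (fun x => fderiv ℝ g x v) D μ :=
    integrableOn_comp_fderiv_fderiv μ hf hg hfin (B := fun p => p.2 v) (by fun_prop)
  have i3 : IntegrableOn
      (fun x => fderiv ℝ f x u * fderiv ℝ g x v - fderiv ℝ f x v * fderiv ℝ g x u) D μ :=
    integrableOn_comp_fderiv_fderiv μ hf hg hfin
      (B := fun p => p.1 u * p.2 v - p.1 v * p.2 u) (by fun_prop)
  have hsplit : ∀ x, (1 + fderiv ℝ f x u) * (1 + fderiv ℝ g x v)
        - fderiv ℝ f x v * fderiv ℝ g x u = (1 + (fderiv ℝ f x u + fderiv ℝ g x v)) +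
        (fderiv ℝ f x u * fderiv ℝ g x v - fderiv ℝ f x v * fderiv ℝ g x u) := fun x => by ring
  simp_rw [hsplit] at key
  have i0 : IntegrableOn (fun _ : E => (1 : ℝ)) D μ := integrableOn_const hfin
  have i12 : IntegrableOn (fun x => fderiv ℝ f x u + fderiv ℝ g x v) D μ := i1.add i2
  have i012 : IntegrableOn (fun x => 1 + (fderiv ℝ f x u + fderiv ℝ g x v)) D μ := i0.add i12
  rw [integral_add i012 i3, integral_add i0 i12, integral_add i1 i2,
    h1, h2, setIntegral_const, smul_eq_mul] at key
  linear_combination key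

end Minors

/-! ### The forms in coordinates, the moment map and the Pfaffian. -/

section LinearAlgebra

theorem omegaV_apply (u v : ℍ) :
    omegaV ![u, v] = (u.re * v.imI - u.imI * v.re) - (u.imJ * v.imK - u.imK * v.imJ) := by
  change ⟪u * qi, v⟫ = _
  simp only [Quaternion.inner_def, Quaternion.re_mul, Quaternion.imI_mul, Quaternion.imJ_mul,
    Quaternion.imK_mul, Quaternion.re_star, Quaternion.imI_star, Quaternion.imJ_star,
    Quaternion.imK_star]
  simp [qi]
  ring

theorem omegaI_apply (u v : ℍ) :
    omegaI ![u, v] = (u.re * v.imI - u.imI * v.re) + (u.imJ * v.imK - u.imK * v.imJ) := by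
  change ⟪qi * u, v⟫ = _
  simp only [Quaternion.inner_def, Quaternion.re_mul, Quaternion.imI_mul, Quaternion.imJ_mul,
    Quaternion.imK_mul, Quaternion.re_star, Quaternion.imI_star, Quaternion.imJ_star,
    Quaternion.imK_star]
  simp [qi]
  ring

theorem omegaJ_apply (u v : ℍ) :
    omegaJ ![u, v] = (u.re * v.imJ - u.imJ * v.re) - (u.imI * v.imK - u.imK * v.imI) := by
  change ⟪qj * u, v⟫ = _
  simp only [Quaternion.inner_def, Quaternion.re_mul, Quaternion.imI_mul, Quaternion.imJ_mul,
    Quaternion.imK_mul, Quaternion.re_star, Quaternion.imI_star, Quaternion.imJ_star,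
    Quaternion.imK_star]
  simp [qj]
  ring

theorem omegaK_apply (u v : ℍ) :
    omegaK ![u, v] = (u.re * v.imK - u.imK * v.re) + (u.imI * v.imJ - u.imJ * v.imI) := by
  change ⟪qk * u, v⟫ = _
  simp only [Quaternion.inner_def, Quaternion.re_mul, Quaternion.imI_mul, Quaternion.imJ_mul,
    Quaternion.imK_mul, Quaternion.re_star, Quaternion.imI_star, Quaternion.imJ_star,
    Quaternion.imK_star]
  simp [qk]
  ring

theorem omegaV_comp_apply (A : ℍ →L[ℝ] ℍ) (u v : ℍ) :
    omegaV.compContinuousLinearMap A ![u, v] = omegaV ![A u, A v] := by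
  rw [ContinuousAlternatingMap.compContinuousLinearMap_apply]
  congr 1
  funext i
  fin_cases i <;> rfl

theorem sigmaV_frame : sigmaV ![1, qi, qj, qk] = -1 := by
  simp only [sigmaV, wedge, Matrix.cons_val, omegaV_apply]
  simp [qi, qj, qk]

/-- For the orientation `1, i, j, k` the forms `ω̂` span the self-dual 2-forms and `ω` is
anti-self-dual; the equations say that `A^*ω` is anti-self-dual too. -/
theorem hyperMoment_eq_zero_iff (A : ℍ →L[ℝ] ℍ) : hyperMoment A = 0 ↔
    omegaV ![A qj, A qk] = -omegaV ![A 1, A qi] ∧ omegaV ![A qi, A qk] = omegaV ![A 1, A qj] ∧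
      omegaV ![A qi, A qj] = -omegaV ![A 1, A qk] := by
  simp only [hyperMoment, moment, sigmaV_frame, wedge, Matrix.cons_val, omegaV_comp_apply,
    omegaI_apply, omegaJ_apply, omegaK_apply,
    Prod.mk_eq_zero]
  generalize omegaV ![A 1, A qi] = a, omegaV ![A 1, A qj] = b, omegaV ![A 1, A qk] = c,
    omegaV ![A qi, A qj] = d, omegaV ![A qi, A qk] = e, omegaV ![A qj, A qk] = f
  simp [qi, qj, qk]
  refine and_congr ?_ (and_congr ?_ ?_) <;> constructor <;> intro h <;> linarith

/-- The basis `1, i, j, k` of the quaternions. -/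
def quaternionBasis : Module.Basis (Fin 4) ℝ ℍ :=
  .ofEquivFun
    { toFun := fun q => ![q.re, q.imI, q.imJ, q.imK]
      invFun := fun a => ⟨a 0, a 1, a 2, a 3⟩
      left_inv := fun q => rfl
      right_inv := fun a => by funext i; fin_cases i <;> rfl
      map_add' := fun p q => by funext i; fin_cases i <;> rfl
      map_smul' := fun c q => by funext i; fin_cases i <;> rfl }

theorem quaternionBasis_repr (q : ℍ) (i : Fin 4) :
    quaternionBasis.repr q i = ![q.re, q.imI, q.imJ, q.imK] i := rfl

theorem coe_quaternionBasis : ⇑quaternionBasis = ![1, qi, qj, qk] := by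
  funext i
  apply quaternionBasis.repr.injective
  ext j
  rw [Module.Basis.repr_self, quaternionBasis_repr]
  fin_cases i <;> fin_cases j <;> simp [qi, qj, qk]

/-- This is `A^*ω ∧ A^*ω = det A · ω ∧ ω` evaluated on `1, i, j, k`; the minus sign is that of
`sigmaV_frame`. -/
theorem det_eq_pfaffian (A : ℍ →L[ℝ] ℍ) :
    A.det = -(omegaV ![A 1, A qi] * omegaV ![A qj, A qk]
      - omegaV ![A 1, A qj] * omegaV ![A qi, A qk]
      + omegaV ![A 1, A qk] * omegaV ![A qi, A qj]) := by
  rw [ContinuousLinearMap.det, ← LinearMap.det_toMatrix quaternionBasis,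
    Matrix.det_succ_row_zero]
  simp [Fin.sum_univ_succ, Matrix.det_fin_three, Fin.succAbove, LinearMap.toMatrix_apply,
    quaternionBasis_repr, coe_quaternionBasis]
  simp only [omegaV_apply]
  ring

theorem alternating_two_ext {a b : ℍ [⋀^Fin 2]→L[ℝ] ℝ}
    (h : a ![1, qi] = b ![1, qi] ∧ a ![1, qj] = b ![1, qj] ∧ a ![1, qk] = b ![1, qk] ∧
      a ![qi, qj] = b ![qi, qj] ∧ a ![qi, qk] = b ![qi, qk] ∧ a ![qj, qk] = b ![qj, qk]) :
    a = b := by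
  obtain ⟨h1, h2, h3, h4, h5, h6⟩ := h
  have hv : ∀ (w : ℍ [⋀^Fin 2]→L[ℝ] ℝ) (u v : ℍ), w ![u, v] = -w ![v, u] := fun w u v => by
    have := w.toAlternatingMap.map_swap ![u, v] (i := 0) (j := 1) (by decide)
    rw [show ![u, v] ∘ ⇑(Equiv.swap (0 : Fin 2) 1) = ![v, u] by
      funext i; fin_cases i <;> rfl] at this
    exact (neg_eq_iff_eq_neg.2 this).symm
  apply ContinuousAlternatingMap.toAlternatingMap_injective
  refine Module.Basis.ext_alternating quaternionBasis fun v hinj => ?_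
  obtain ⟨i, j, rfl⟩ : ∃ i j, v = ![i, j] := ⟨v 0, v 1, by funext k; fin_cases k <;> rfl⟩
  have hij : i ≠ j := fun h => by simpa using hinj (a₁ := 0) (a₂ := 1) (by simpa using h)
  rw [show (fun k => quaternionBasis (![i, j] k)) = ![quaternionBasis i, quaternionBasis j] by
    funext k; fin_cases k <;> rfl, coe_quaternionBasis]
  change a _ = b _
  have key : ∀ i j : Fin 4, i < j → a ![(![1, qi, qj, qk] : Fin 4 → ℍ) i,
      (![1, qi, qj, qk] : Fin 4 → ℍ) j] = b ![(![1, qi, qj, qk] : Fin 4 → ℍ) i,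
      (![1, qi, qj, qk] : Fin 4 → ℍ) j] := by
    intro i j hlt
    fin_cases i <;> fin_cases j <;> first | exact absurd hlt (by decide) | assumption
  rcases lt_or_gt_of_ne hij with hlt | hlt
  · exact key i j hlt
  · rw [hv a, hv b, key j i hlt]

end LinearAlgebra

/-! ### Lifts of torus maps to `ℍ` and their periods. -/

section Lifts

open scoped NNReal unitInterval

variable {Γ : Submodule ℤ ℍ}

theorem proj_eq_proj_iff {x y : ℍ} : proj Γ x = proj Γ y ↔ x - y ∈ Γ := by
  rw [eq_comm, proj, proj, QuotientAddGroup.eq, neg_add_eq_sub]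
  rfl

theorem proj_add {x γ : ℍ} (hγ : γ ∈ Γ) : proj Γ (x + γ) = proj Γ x := by
  rw [proj_eq_proj_iff]
  simpa using hγ

theorem continuous_proj : Continuous (proj Γ) := continuous_quotient_mk'

theorem proj_surjective : Function.Surjective (proj Γ) := QuotientAddGroup.mk_surjective

variable [DiscreteTopology Γ]

theorem isDiscrete_lattice : IsDiscrete (Γ : Set ℍ) := isDiscrete_iff_discreteTopology.2 ‹_›

theorem isCoveringMap_proj : IsCoveringMap (proj Γ) :=
  (AddSubgroup.isAddQuotientCoveringMap_of_comm Γ.toAddSubgroup isDiscrete_lattice).isCoveringMap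

theorem eventuallyEq_of_mem_lattice {X : Type*} [TopologicalSpace X] {d : X → ℍ} {x : X}
    (hd : ContinuousAt d x) (hmem : ∀ᶠ y in 𝓝 x, d y ∈ Γ) : ∀ᶠ y in 𝓝 x, d y = d x := by
  have hx : d x ∈ Γ := hmem.self_of_nhds
  have h1 : 𝓝[(Γ : Set ℍ)] (d x) = pure (d x) :=
    isDiscrete_iff_nhdsWithin.1 isDiscrete_lattice _ hx
  have h2 : Tendsto d (𝓝 x) (𝓝[(Γ : Set ℍ)] (d x)) :=
    tendsto_nhdsWithin_of_tendsto_nhds_of_eventually_within _ hd hmem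
  rw [h1] at h2
  exact tendsto_pure.1 h2

/-- After a lattice translation the two local lifts are based at the same point; their difference
takes values in `Γ`, so it is locally constant. Thus the choice in `torusDeriv` is immaterial. -/
theorem HasTorusDerivAt.unique {f : Torus Γ → Torus Γ} {x : Torus Γ} {L M : ℍ →L[ℝ] ℍ}
    (hL : HasTorusDerivAt Γ f x L) (hM : HasTorusDerivAt Γ f x M) : L = M := by
  obtain ⟨x₁, g₁, rfl, hg₁, hd₁⟩ := hL
  obtain ⟨x₂, g₂, hx₂, hg₂, hd₂⟩ := hM
  have hγ : x₂ - x₁ ∈ Γ := proj_eq_proj_iff.1 hx₂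
  have hd₂' : HasFDerivAt (fun y => g₂ (y + (x₂ - x₁))) M x₁ := by
    rw [hasFDerivAt_comp_add_right]
    simpa using hd₂
  have hg₂' : ∀ᶠ y in 𝓝 x₁, proj Γ (g₂ (y + (x₂ - x₁))) = f (proj Γ y) := by
    have ht : Tendsto (fun y => y + (x₂ - x₁)) (𝓝 x₁) (𝓝 x₂) := by
      have : ContinuousAt (fun y => y + (x₂ - x₁)) x₁ := by fun_prop
      simpa [ContinuousAt] using this
    filter_upwards [ht.eventually hg₂] with y hy
    rw [hy, proj_add hγ]
  have hsub := hd₁.sub hd₂'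
  have hconst := eventuallyEq_of_mem_lattice (Γ := Γ) hsub.continuousAt (by
    filter_upwards [hg₁, hg₂'] with y h1 h2
    exact proj_eq_proj_iff.1 (h1.trans h2.symm))
  have h0 := (hasFDerivAt_const (𝕜 := ℝ) _ x₁).congr_of_eventuallyEq hconst
  exact sub_eq_zero.1 (hsub.unique h0)

theorem torusDeriv_proj {f : Torus Γ → Torus Γ} {F : ℍ → ℍ} {x : ℍ} {L : ℍ →L[ℝ] ℍ}
    (hF : ∀ y, proj Γ (F y) = f (proj Γ y)) (hL : HasFDerivAt F L x) :
    torusDeriv Γ f (proj Γ x) = L := by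
  have h : HasTorusDerivAt Γ f (proj Γ x) L := ⟨x, F, rfl, .of_forall hF, hL⟩
  have hex : ∃ L, HasTorusDerivAt Γ f (proj Γ x) L := ⟨L, h⟩
  rw [torusDeriv, dif_pos hex]
  exact hex.choose_spec.unique h

theorem lift_add_sub_eq {F : ℍ → ℍ} (hF : Continuous F) {f : Torus Γ → Torus Γ}
    (hlift : ∀ y, proj Γ (F y) = f (proj Γ y)) {γ : ℍ} (hγ : γ ∈ Γ) (x y : ℍ) :
    F (x + γ) - F x = F (y + γ) - F y := by
  have hcont : ContinuousOn (fun z => F (z + γ) - F z) univ := by fun_prop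
  refine isPreconnected_univ.constant_of_mapsTo (isDiscrete_lattice (Γ := Γ)) hcont (fun z _ => ?_)
    (mem_univ x) (mem_univ y)
  exact proj_eq_proj_iff.1 (by rw [hlift, hlift, proj_add hγ])

/-- A lift of a torus map along a homotopy, with the same periods as the given lift at the other
end. -/
theorem exists_lift_of_homotopic {f g : C(Torus Γ, Torus Γ)} (hfg : f.Homotopic g) {G : ℍ → ℍ}
    (hG : Continuous G) (hlift : ∀ y, proj Γ (G y) = g (proj Γ y)) :
    ∃ F : ℍ → ℍ, Continuous F ∧ (∀ y, proj Γ (F y) = f (proj Γ y)) ∧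
      ∀ x, ∀ γ ∈ Γ, F (x + γ) - F x = G (x + γ) - G x := by
  obtain ⟨H⟩ := hfg.symm
  let H' : C(I × ℍ, Torus Γ) :=
    ⟨fun p => H (p.1, proj Γ p.2), by have := continuous_proj (Γ := Γ); fun_prop⟩
  have h0 : ∀ a, H' (0, a) = proj Γ ((⟨G, hG⟩ : C(ℍ, ℍ)) a) := fun a => by simp [H', hlift]
  let K := isCoveringMap_proj.liftHomotopy H' ⟨G, hG⟩ h0
  have hK : ∀ p, proj Γ (K p) = H (p.1, proj Γ p.2) := fun p =>
    congrFun (isCoveringMap_proj.liftHomotopy_lifts H' ⟨G, hG⟩ h0) p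
  have hK0 : ∀ a, K (0, a) = G a := isCoveringMap_proj.liftHomotopy_zero H' ⟨G, hG⟩ h0
  refine ⟨fun x => K (1, x), by fun_prop, fun y => by simp [hK], fun x γ hγ => ?_⟩
  -- The period along `γ` is a continuous lattice-valued function on the connected space `I × ℍ`, so
  -- it agrees at both ends of the homotopy.
  have hcont : ContinuousOn (fun p : I × ℍ => K (p.1, p.2 + γ) - K p) univ := by fun_prop
  have := isPreconnected_univ.constant_of_mapsTo (isDiscrete_lattice (Γ := Γ)) hcont (fun z _ =>
    proj_eq_proj_iff.1 (by rw [hK, hK, proj_add hγ])) (mem_univ ((1 : I), x))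
    (mem_univ ((0 : I), x))
  simpa [hK0] using this

variable [IsZLattice ℝ Γ]

/-- The increment `F (x + γ) - F x` does not depend on `x`, hence is additive in `γ`; a `ℤ`-basis of
`Γ` is a real basis of `ℍ`, so it extends linearly. -/
theorem exists_linear_periods {F : ℍ → ℍ} (hF : Continuous F) {f : Torus Γ → Torus Γ}
    (hlift : ∀ y, proj Γ (F y) = f (proj Γ y)) :
    ∃ L : ℍ →L[ℝ] ℍ, ∀ x, ∀ γ ∈ Γ, F (x + γ) = F x + L γ := by
  let φ : Γ →+ ℍ := AddMonoidHom.mk' (fun γ => F γ - F 0) fun γ δ => by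
    have := lift_add_sub_eq hF hlift δ.2 (γ : ℍ) 0
    rw [zero_add] at this
    rw [← this]
    simp
  let b := Module.Free.chooseBasis ℤ Γ
  let L := (b.ofZLatticeBasis ℝ Γ).constr ℝ fun i => φ (b i)
  have hLφ : (L.restrictScalars ℤ).comp Γ.subtype = φ.toIntLinearMap := by
    refine b.ext fun i => ?_
    have := (b.ofZLatticeBasis ℝ Γ).constr_basis ℝ (fun i => φ (b i)) i
    rw [b.ofZLatticeBasis_apply ℝ Γ] at this
    exact this
  refine ⟨LinearMap.toContinuousLinearMap L, fun x γ hγ => ?_⟩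
  have h1 : L γ = F γ - F 0 := LinearMap.congr_fun hLφ ⟨γ, hγ⟩
  have h2 := lift_add_sub_eq hF hlift hγ x 0
  rw [zero_add, ← h1, sub_eq_iff_eq_add'] at h2
  exact h2

theorem exists_norm_le_of_periodic {V : Type*} [NormedAddCommGroup V] {k : ℍ → V}
    (hk : Continuous k) (hper : ∀ x, ∀ γ ∈ Γ, k (x + γ) = k x) : ∃ C : ℝ≥0, ∀ x, ‖k x‖₊ ≤ C := by
  let b := (Module.Free.chooseBasis ℤ Γ).ofZLatticeBasis ℝ Γ
  obtain ⟨C, hC⟩ :=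
    (ZSpan.fundamentalDomain_isBounded b).isCompact_closure.exists_bound_of_continuousOn
      hk.continuousOn
  refine ⟨C.toNNReal, fun x => ?_⟩
  obtain ⟨v, hv, -⟩ := ZSpan.exist_unique_vadd_mem_fundamentalDomain b x
  have hvΓ : (v : ℍ) ∈ Γ :=
    ((Module.Free.chooseBasis ℤ Γ).ofZLatticeBasis_span ℝ Γ).le v.2
  rw [← NNReal.coe_le_coe, coe_nnnorm]
  refine le_trans ?_ (Real.le_coe_toNNReal C)
  rw [← hper x v hvΓ, add_comm]
  exact hC _ (subset_closure hv)

theorem exists_lipschitzWith_of_periods {V : Type*} [NormedAddCommGroup V] [NormedSpace ℝ V]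
    {F : ℍ → V} (hF : ContDiff ℝ 1 F) {l : ℍ → V} (hper : ∀ x, ∀ γ ∈ Γ, F (x + γ) = F x + l γ) :
    ∃ K : ℝ≥0, LipschitzWith K F := by
  obtain ⟨C, hC⟩ := exists_norm_le_of_periodic (Γ := Γ) (hF.continuous_fderiv one_ne_zero)
    (fun x γ hγ => by
      rw [← fderiv_comp_add_right, show (fun y => F (y + γ)) = fun y => F y + l γ from
        funext fun y => hper y γ hγ, fderiv_add_const])
  exact ⟨C, lipschitzWith_of_nnnorm_fderiv_le (hF.differentiable one_ne_zero) hC⟩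

end Lifts

/-! ### Lipschitz and differential properties of lifts of polyhedral maps. -/

section Piecewise

open scoped NNReal

/-- A continuous map that is `K`-Lipschitz on each member of a locally finite closed cover is
`K`-Lipschitz. -/
theorem lipschitzWith_of_locallyFinite_cover {E W ι : Type*} [NormedAddCommGroup E]
    [NormedSpace ℝ E] [NormedAddCommGroup W] [NormedSpace ℝ W] {F : E → W} (hF : Continuous F)
    {C : ι → Set E} (hC : LocallyFinite C) (hclosed : ∀ i, IsClosed (C i))
    (hcover : ∀ x, ∃ i, x ∈ C i) {K : ℝ≥0} (hK : ∀ i, LipschitzOnWith K F (C i)) :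
    LipschitzWith K F := by
  refine LipschitzWith.of_dist_le_mul fun x y => ?_
  set l : ℝ → E := fun t => y + t • (x - y) with hl
  have hlc : Continuous l := by fun_prop
  set φ : ℝ → W := fun t => F (l t) - F y with hφ
  have hφc : Continuous φ := by fun_prop
  have hslope : ∀ t ∈ Ico (0 : ℝ) 1, ∀ r, K * ‖x - y‖ < r →
      ∃ᶠ z in 𝓝[>] t, slope (norm ∘ φ) t z < r := by
    intro t _ r hr
    obtain ⟨U, hU, hfin⟩ := hC (l t)
    -- By local finiteness one piece contains `l z` for `z` arbitrarily close to `t` on the right;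
    -- being closed, it contains `l t`, which bounds the slope between them.
    have hev : ∀ᶠ z in 𝓝[>] t, ∃ i ∈ {i | (C i ∩ U).Nonempty}, l z ∈ C i := by
      filter_upwards [nhdsWithin_le_nhds (hlc.continuousAt hU)] with z hz
      obtain ⟨i, hi⟩ := hcover (l z)
      exact ⟨i, ⟨_, hi, hz⟩, hi⟩
    obtain ⟨i, -, hi⟩ := (frequently_exists_finite hfin).1 hev.frequently
    have ht : l t ∈ C i := by
      refine ((hclosed i).preimage hlc).mem_of_frequently_of_tendsto hi ?_
      exact nhdsWithin_le_nhds
    refine (hi.and_eventually self_mem_nhdsWithin).mono fun z ⟨hz, hzt⟩ => ?_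
    have hzt' : 0 < z - t := sub_pos.2 hzt
    refine lt_of_le_of_lt ?_ hr
    rw [slope_def_field, div_le_iff₀ hzt']
    calc (norm ∘ φ) z - (norm ∘ φ) t ≤ ‖φ z - φ t‖ := norm_sub_norm_le _ _
      _ = dist (F (l z)) (F (l t)) := by simp [hφ, dist_eq_norm]
      _ ≤ K * dist (l z) (l t) := (hK i).dist_le_mul _ hz _ ht
      _ = K * ‖x - y‖ * (z - t) := by
        rw [dist_eq_norm, hl]
        simp only [add_sub_add_left_eq_sub]
        rw [← sub_smul, norm_smul, Real.norm_of_nonneg hzt'.le]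
        ring
  -- The comparison lemma asks for a strict inequality of slopes, hence the `ε`.
  refine le_of_forall_pos_le_add fun ε hε => ?_
  have := image_norm_le_of_liminf_right_slope_norm_lt_deriv_boundary hφc.continuousOn hslope
    (B := fun t => (K * ‖x - y‖ + ε) * t) (B' := fun _ => K * ‖x - y‖ + ε) (by simp [hφ, hl])
    (by fun_prop)
    (fun t _ => by simpa using ((hasDerivAt_id t).const_mul (K * ‖x - y‖ + ε)).hasDerivWithinAt)
    (fun t _ _ => by linarith) (right_mem_Icc.2 zero_le_one)
  simpa [hφ, hl, dist_eq_norm] using this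

variable {Γ : Submodule ℤ ℍ} {T : EuclideanTriangulation Γ} {f : C(Torus Γ, Torus Γ)}

/-- Off the 3-skeleton the simplex must have five vertices, and a vanishing barycentric coordinate
would put `y` on a facet, which is a 3-dimensional cell. -/
theorem EuclideanTriangulation.mem_interior_of_notMem_skeleton {σ : Set (Torus Γ)}
    (hσ : σ ∈ T.cells) {s : Finset ℍ} (hs : IsSimplexLift Γ s σ) {y : ℍ}
    (hy : y ∈ convexHull ℝ (s : Set ℍ)) (hskel : proj Γ y ∉ T.skeleton 3) :
    y ∈ interior (convexHull ℝ (s : Set ℍ)) := by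
  classical
  have hpos : 0 < s.card := hs.1.card_pos
  have hrank : Module.finrank ℝ ℍ = 4 := Quaternion.finrank_eq_four
  have hcard : s.card = 5 := by
    have h1 := hs.2.1.card_le_finrank_succ
    have h2 := Submodule.finrank_le (vectorSpan ℝ (range ((↑) : s → ℍ)))
    rw [Fintype.card_coe] at h1
    by_contra hne
    exact hskel ⟨σ, ⟨hσ, s.card - 1, by omega, s, by omega, hs⟩, hs.2.2.mapsTo hy⟩
  let b : AffineBasis s ℝ ℍ := ⟨_, hs.2.1,
    (hs.2.1.affineSpan_eq_top_iff_card_eq_finrank_add_one).2 (by simp [hcard, hrank])⟩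
  have hb : range b = (s : Set ℍ) := Subtype.range_coe
  have hnonneg : ∀ i, 0 ≤ b.coord i y := by
    rw [← hb, b.convexHull_eq_nonneg_coord] at hy
    exact hy
  rw [← hb, b.interior_convexHull]
  intro i
  refine (hnonneg i).lt_of_ne' fun hi => hskel ?_
  have hyt : y ∈ convexHull ℝ (s.erase i : Set ℍ) := by
    rw [← b.linear_combination_coord_eq_self y]
    have hsplit : ∀ g : s → ℍ, g i = 0 → ∑ j, g j = ∑ j ∈ Finset.univ.erase i, g j :=
      fun g hg => (Finset.sum_erase _ hg).symm
    rw [hsplit _ (by rw [hi, zero_smul])]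
    refine (convex_convexHull ℝ _).sum_mem (fun j _ => hnonneg j) ?_ fun j hj => ?_
    · rw [Finset.sum_erase (f := fun j => b.coord j y) _ hi, b.sum_coord_apply_eq_one]
    · refine subset_convexHull ℝ _ ?_
      have : j ≠ i := (Finset.mem_erase.1 hj).1
      exact Finset.mem_coe.2 (Finset.mem_erase.2 ⟨fun h => this (Subtype.ext h), j.2⟩)
  have hsub : (s.erase i : Finset ℍ) ⊆ s := Finset.erase_subset _ _
  have hct : (s.erase i : Finset ℍ).card = 4 := by rw [Finset.card_erase_of_mem i.2, hcard]
  have ht : IsSimplexLift Γ (s.erase i) (proj Γ '' convexHull ℝ (s.erase i : Finset ℍ)) :=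
    ⟨Finset.card_pos.1 (by omega), hs.2.1.mono hsub,
      (hs.2.2.injOn.mono (convexHull_mono hsub)).bijOn_image⟩
  exact ⟨_, ⟨T.face_mem σ hσ _ ⟨s, hs, _, hsub, ht⟩, 3, le_rfl, _, hct, ht⟩,
    mem_image_of_mem _ (by simpa using hyt)⟩

theorem EuclideanTriangulation.measure_preimage_skeleton [MeasurableSpace ℍ] [BorelSpace ℍ]
    (μ : Measure ℍ) [μ.IsAddHaarMeasure] [Countable Γ] (T : EuclideanTriangulation Γ) :
    μ (proj Γ ⁻¹' T.skeleton 3) = 0 := by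
  rw [EuclideanTriangulation.skeleton, preimage_sUnion]
  refine (measure_biUnion_null_iff (T.finite.subset (sep_subset _ _)).countable).2 ?_
  rintro σ ⟨-, m, hm, s, hcard, hs⟩
  have hnull : μ (convexHull ℝ (s : Set ℍ)) = 0 := by
    refine measure_mono_null (convexHull_subset_affineSpan _)
      (Measure.addHaar_affineSubspace μ _ fun htop => ?_)
    have := hs.2.1.affineSpan_eq_top_iff_card_eq_finrank_add_one.1 (by simpa using htop)
    rw [Fintype.card_coe, Quaternion.finrank_eq_four] at this
    omega
  have hsub : proj Γ ⁻¹' σ ⊆ ⋃ γ : Γ, (fun x => x + (-γ : ℍ)) ⁻¹' convexHull ℝ (s : Set ℍ) := by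
    intro x hx
    obtain ⟨y, hy, hyx⟩ := hs.2.2.surjOn hx
    exact mem_iUnion.2 ⟨⟨x - y, proj_eq_proj_iff.1 hyx.symm⟩, by simpa using hy⟩
  refine measure_mono_null hsub (measure_iUnion_null fun γ => ?_)
  rw [measure_preimage_add_right, hnull]

variable [DiscreteTopology Γ]

/-- On a simplex, `F (x + γ)` and the given affine lift differ by a continuous lattice-valued
function, hence by a constant. So one linear part `A` serves all translates of the simplex, and
finitely many serve the whole of `ℍ`. -/
theorem IsPolyhedral.lift_affine (hf : IsPolyhedral T f) {F : ℍ → ℍ} (hF : Continuous F)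
    (hlift : ∀ y, proj Γ (F y) = f (proj Γ y)) {σ : Set (Torus Γ)} (hσ : σ ∈ T.cells) :
    ∃ s : Finset ℍ, IsSimplexLift Γ s σ ∧ ∃ A : ℍ →L[ℝ] ℍ, ∀ γ ∈ Γ, ∃ c : ℍ,
      ∀ x ∈ convexHull ℝ (s : Set ℍ), F (x + γ) = A x + c := by
  obtain ⟨s, hs, A, hA⟩ := hf σ hσ
  refine ⟨s, hs, LinearMap.toContinuousLinearMap A.linear, fun γ hγ => ?_⟩
  have hAc : Continuous A := A.continuous_of_finiteDimensional
  obtain ⟨x₀, hx₀⟩ : (convexHull ℝ (s : Set ℍ)).Nonempty := by simpa using hs.1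
  have hcont : ContinuousOn (fun x => F (x + γ) - A x) (convexHull ℝ (s : Set ℍ)) := by fun_prop
  refine ⟨F (x₀ + γ) - A x₀ + A 0, fun x hx => ?_⟩
  have := (convex_convexHull ℝ (s : Set ℍ)).isPreconnected.constant_of_mapsTo
    (isDiscrete_lattice (Γ := Γ)) hcont
    (fun z hz => proj_eq_proj_iff.1 (by rw [hlift, proj_add hγ, hA z hz])) hx hx₀
  have hdec : A x = A.linear x + A 0 := congrFun A.decomp x
  rw [← this, hdec, LinearMap.coe_toContinuousLinearMap']
  abel

theorem IsPolyhedral.exists_lipschitzWith_lift [IsZLattice ℝ Γ] (hf : IsPolyhedral T f) {F : ℍ → ℍ}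
    (hF : Continuous F) (hlift : ∀ y, proj Γ (F y) = f (proj Γ y)) :
    ∃ K : ℝ≥0, LipschitzWith K F := by
  choose! s hs A hA using fun σ => hf.lift_affine hF hlift (σ := σ)
  have := T.finite.to_subtype
  obtain ⟨K, hK⟩ : ∃ K : ℝ≥0, ∀ σ : T.cells, ‖A σ‖₊ ≤ K := by
    obtain ⟨K, hK⟩ := (finite_range fun σ : T.cells => ‖A σ‖₊).bddAbove
    exact ⟨K, fun σ => hK (mem_range_self σ)⟩
  obtain ⟨R, hR⟩ : ∃ R : ℝ, ∀ σ : T.cells, ∀ x ∈ convexHull ℝ (s σ : Set ℍ), ‖x‖ ≤ R := by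
    have hb : Bornology.IsBounded (⋃ σ : T.cells, convexHull ℝ (s σ : Set ℍ)) := by
      rw [Bornology.isBounded_iUnion]
      exact fun σ => isBounded_convexHull.2 (s σ).finite_toSet.isBounded
    obtain ⟨R, hR⟩ := hb.exists_norm_le
    exact ⟨R, fun σ x hx => hR x (mem_iUnion.2 ⟨σ, hx⟩)⟩
  -- All lattice translates of the lifted simplices: a locally finite closed cover, since the
  -- simplices are uniformly bounded and `Γ` is discrete.
  let C : T.cells × Γ → Set ℍ := fun p => (fun x => x - p.2) ⁻¹' convexHull ℝ (s p.1 : Set ℍ)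
  have hΓ : ∀ r : ℝ, {γ : Γ | ‖(γ : ℍ)‖ ≤ r}.Finite := by
    intro r
    have hcl : IsClosed (Γ : Set ℍ) := by
      rw [← Submodule.coe_toAddSubgroup]
      have : DiscreteTopology Γ.toAddSubgroup := ‹DiscreteTopology Γ›
      exact AddSubgroup.isClosed_of_discrete
    have := Metric.finite_isBounded_inter_isClosed
      (isDiscrete_lattice (Γ := Γ))
      (Metric.isBounded_closedBall (x := (0 : ℍ)) (r := r)) hcl
    refine Finite.of_finite_image (f := ((↑) : Γ → ℍ)) (this.subset ?_)
      Subtype.val_injective.injOn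
    rintro _ ⟨γ, hγ, rfl⟩
    exact ⟨by simpa using hγ, γ.2⟩
  refine ⟨K, lipschitzWith_of_locallyFinite_cover hF (C := C) ?_ ?_ ?_ ?_⟩
  · intro x
    refine ⟨Metric.ball x 1, Metric.ball_mem_nhds x one_pos, ?_⟩
    refine (finite_univ.prod (hΓ (‖x‖ + 1 + R))).subset ?_
    rintro ⟨σ, γ⟩ ⟨y, hy, hyx⟩
    refine ⟨mem_univ _, ?_⟩
    have h1 : ‖y - γ‖ ≤ R := hR σ _ hy
    have h2 : ‖y - x‖ < 1 := by simpa [dist_eq_norm] using hyx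
    calc ‖(γ : ℍ)‖ = ‖x + (y - x) - (y - γ)‖ := by congr 1; abel
      _ ≤ ‖x‖ + ‖y - x‖ + ‖y - γ‖ := (norm_sub_le _ _).trans (by gcongr; exact norm_add_le _ _)
      _ ≤ _ := by gcongr
  · rintro ⟨σ, γ⟩
    exact ((s σ).finite_toSet.isCompact_convexHull ℝ).isClosed.preimage (by fun_prop)
  · intro x
    obtain ⟨σ, hσ, hx⟩ : proj Γ x ∈ ⋃₀ T.cells := T.cover ▸ mem_univ _
    obtain ⟨y, hy, hyx⟩ := (hs σ hσ).2.2.surjOn hx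
    exact ⟨⟨⟨σ, hσ⟩, ⟨x - y, proj_eq_proj_iff.1 hyx.symm⟩⟩, by simpa [C] using hy⟩
  · rintro ⟨σ, γ⟩
    obtain ⟨c, hc⟩ := hA σ σ.2 γ γ.2
    refine LipschitzOnWith.of_dist_le_mul fun x hx y hy => ?_
    have hx' := hc _ hx
    have hy' := hc _ hy
    simp only [sub_add_cancel] at hx' hy'
    rw [hx', hy', dist_add_right, dist_eq_norm, ← map_sub, sub_sub_sub_cancel_right, dist_eq_norm]
    exact (A σ).le_of_opNorm_le (hK σ) _

theorem IsPolyhedral.exists_eventually_hasFDerivAt (hf : IsPolyhedral T f) {F : ℍ → ℍ}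
    (hF : Continuous F) (hlift : ∀ y, proj Γ (F y) = f (proj Γ y)) {x : ℍ}
    (hx : proj Γ x ∉ T.skeleton 3) : ∃ A : ℍ →L[ℝ] ℍ, ∀ᶠ z in 𝓝 x, HasFDerivAt F A z := by
  obtain ⟨σ, hσ, hxσ⟩ : proj Γ x ∈ ⋃₀ T.cells := T.cover ▸ mem_univ _
  obtain ⟨s, hs, A, hA⟩ := hf.lift_affine hF hlift hσ
  obtain ⟨y, hy, hyx⟩ := hs.2.2.surjOn hxσ
  obtain ⟨c, hc⟩ := hA (x - y) (proj_eq_proj_iff.1 hyx.symm)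
  have hint := T.mem_interior_of_notMem_skeleton hσ hs hy (hyx ▸ hx)
  have hev : ∀ᶠ z in 𝓝 x, F z = A (z - (x - y)) + c := by
    have hcont : ContinuousAt (fun z => z - (x - y)) x := by fun_prop
    have : convexHull ℝ (s : Set ℍ) ∈ 𝓝 (x - (x - y)) := by
      rw [sub_sub_cancel]
      exact mem_interior_iff_mem_nhds.1 hint
    filter_upwards [hcont this] with z hz
    rw [← hc _ hz, sub_add_cancel]
  refine ⟨A, hev.eventually_nhds.mono fun z hz => ?_⟩
  refine HasFDerivAt.congr_of_eventuallyEq ?_ hz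
  exact ((A.hasFDerivAt (x := z - (x - y))).comp z
    ((hasFDerivAt_id z).sub_const (x - y))).add_const c

end Piecewise

/-! ### The integral identities for `ω` and the equality case. -/

section MomentMap

open scoped NNReal

theorem continuous_omegaV_comp (u v : ℍ) :
    Continuous fun A : ℍ →L[ℝ] ℍ => omegaV ![A u, A v] := by
  simp only [omegaV_apply]
  have := Quaternion.continuous_re
  have := Quaternion.continuous_imI
  have := Quaternion.continuous_imJ
  have := Quaternion.continuous_imK
  fun_prop

theorem pullback_omegaV_eq_of_hyperMoment_eq_zero {A : ℍ →L[ℝ] ℍ} (hA : hyperMoment A = 0)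
    (hdet : A.det - 2 * omegaV ![A 1, A qi] + 1 = 0) :
    omegaV.compContinuousLinearMap A = omegaV := by
  obtain ⟨h1, h2, h3⟩ := (hyperMoment_eq_zero_iff A).1 hA
  rw [det_eq_pfaffian, h1, h2, h3] at hdet
  -- `hdet` now reads `(a - 1)² + b² + c² = 0`.
  have e1 : omegaV ![A 1, A qi] = 1 := by
    nlinarith [sq_nonneg (omegaV ![A 1, A qi] - 1), sq_nonneg (omegaV ![A 1, A qj]),
      sq_nonneg (omegaV ![A 1, A qk])]
  have e2 : omegaV ![A 1, A qj] = 0 := by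
    nlinarith [sq_nonneg (omegaV ![A 1, A qi] - 1), sq_nonneg (omegaV ![A 1, A qj]),
      sq_nonneg (omegaV ![A 1, A qk])]
  have e3 : omegaV ![A 1, A qk] = 0 := by
    nlinarith [sq_nonneg (omegaV ![A 1, A qi] - 1), sq_nonneg (omegaV ![A 1, A qj]),
      sq_nonneg (omegaV ![A 1, A qk])]
  apply alternating_two_ext
  simp only [omegaV_comp_apply, h1, h2, h3, e1, e2, e3]
  simp only [omegaV_apply]
  simp [qi, qj, qk]

variable [MeasurableSpace ℍ] [BorelSpace ℍ] (μ : Measure ℍ) [μ.IsAddHaarMeasure]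
  {Γ : Submodule ℤ ℍ} [Countable Γ] {D : Set ℍ}

theorem setIntegral_coord_minor (hD : IsAddFundamentalDomain Γ D μ) (hfin : μ D ≠ ⊤)
    {F : ℍ → ℍ} {K : ℝ≥0} (hF : LipschitzWith K F) {L : ℍ →L[ℝ] ℍ}
    (hL : ∀ x, ∀ γ ∈ Γ, F (x + γ) = F x + L γ) (α β : ℍ →L[ℝ] ℝ) (u v : ℍ) :
    ∫ x in D, (α (fderiv ℝ F x u) * β (fderiv ℝ F x v)
        - α (fderiv ℝ F x v) * β (fderiv ℝ F x u)) ∂μ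
      = μ.real D * (α (L u) * β (L v) - α (L v) * β (L u)) := by
  have key := setIntegral_minor μ hD hfin (α.lipschitz.comp hF) (β.lipschitz.comp hF)
    (l := α.comp L) (m := β.comp L) (fun x γ hγ => by simp [hL x γ hγ])
    (fun x γ hγ => by simp [hL x γ hγ]) u v
  simp only [ContinuousLinearMap.comp_apply] at key
  rw [← key]
  refine integral_congr_ae (ae_restrict_of_ae ?_)
  filter_upwards [hF.ae_differentiableAt (μ := μ)] with x hx
  rw [(α.hasFDerivAt.comp x hx.hasFDerivAt).fderiv, (β.hasFDerivAt.comp x hx.hasFDerivAt).fderiv]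
  rfl

theorem setIntegral_omegaV_fderiv (hD : IsAddFundamentalDomain Γ D μ) (hfin : μ D ≠ ⊤)
    {F : ℍ → ℍ} {K : ℝ≥0} (hF : LipschitzWith K F) {L : ℍ →L[ℝ] ℍ}
    (hL : ∀ x, ∀ γ ∈ Γ, F (x + γ) = F x + L γ) (u v : ℍ) :
    ∫ x in D, omegaV ![fderiv ℝ F x u, fderiv ℝ F x v] ∂μ
      = μ.real D * omegaV ![L u, L v] := by
  let c : Fin 4 → ℍ →L[ℝ] ℝ := fun i => LinearMap.toContinuousLinearMap (quaternionBasis.coord i)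
  have hω : ∀ p q : ℍ, omegaV ![p, q]
      = (c 0 p * c 1 q - c 0 q * c 1 p) - (c 2 p * c 3 q - c 2 q * c 3 p) := fun p q => by
    rw [omegaV_apply]
    change _ = (p.re * q.imI - q.re * p.imI) - (p.imJ * q.imK - q.imJ * p.imK)
    ring
  simp_rw [hω]
  rw [integral_sub, setIntegral_coord_minor μ hD hfin hF hL,
    setIntegral_coord_minor μ hD hfin hF hL]
  · ring
  · exact integrableOn_comp_fderiv μ hF hfin
      (B := fun A => c 0 (A u) * c 1 (A v) - c 0 (A v) * c 1 (A u)) (by fun_prop)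
  · exact integrableOn_comp_fderiv μ hF hfin
      (B := fun A => c 2 (A u) * c 3 (A v) - c 2 (A v) * c 3 (A u)) (by fun_prop)

/-- Average `G^*ω - ω = dη` over a period: the left side gives `L^*ω - ω`, while the right side
gives `0`, because the coefficients of `η` are periodic. -/
theorem omegaV_periods_of_cohomologous [DiscreteTopology Γ] [IsZLattice ℝ Γ]
    (hD : IsAddFundamentalDomain Γ D μ) (hfin : μ D ≠ ⊤) (hpos : μ D ≠ 0) {g : Torus Γ → Torus Γ}
    (hcoh : Cohomologous Γ (pullback Γ g (omegaM Γ)) (omegaM Γ)) {G : ℍ → ℍ}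
    (hG : ContDiff ℝ ∞ G) (hlift : ∀ y, proj Γ (G y) = g (proj Γ y)) {L : ℍ →L[ℝ] ℍ}
    (hL : ∀ x, ∀ γ ∈ Γ, G (x + γ) = G x + L γ) (u v : ℍ) :
    omegaV ![L u, L v] = omegaV ![u, v] := by
  obtain ⟨η, hη, heq⟩ := hcoh
  obtain ⟨K, hK⟩ := exists_lipschitzWith_of_periods (hG.of_le (by simp)) hL
  let h : ℍ → ℍ → ℝ := fun w x => η (proj Γ x) ![w]
  have hh : ∀ w, ContDiff ℝ ∞ (h w) := fun w => by
    have he : ContDiff ℝ ∞ (ContinuousAlternatingMap.apply ℝ ℍ ℝ (![w] : Fin 1 → ℍ)) := by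
      fun_prop
    have hη' : ContDiff ℝ ∞ fun x => η (proj Γ x) := hη
    exact he.comp hη'
  have hper : ∀ w x, ∀ γ ∈ Γ, h w (x + γ) = h w x + (0 : ℍ →L[ℝ] ℝ) γ := fun w x γ hγ => by
    simp [h, proj_add hγ]
  have hlip : ∀ w, ∃ K : ℝ≥0, LipschitzWith K (h w) := fun w =>
    exists_lipschitzWith_of_periods ((hh w).of_le (by simp)) (hper w)
  choose Kh hKh using hlip
  have hηd : Differentiable ℝ fun x => η (proj Γ x) := hη.differentiable (by simp)
  have hpt : ∀ x, omegaV ![fderiv ℝ G x u, fderiv ℝ G x v] - omegaV ![u, v]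
      = fderiv ℝ (h v) x u - fderiv ℝ (h u) x v := by
    intro x
    have := congrArg (fun w => w ![u, v]) (heq x)
    simp only [pullback, omegaM, ContinuousAlternatingMap.sub_apply,
      torusDeriv_proj hlift ((hG.differentiable (by simp)) x).hasFDerivAt] at this
    rw [omegaV_comp_apply, extDeriv_apply (hηd x)] at this
    have r0 : (0 : Fin 2).removeNth ![u, v] = ![v] := by funext i; fin_cases i; rfl
    have r1 : (1 : Fin 2).removeNth ![u, v] = ![u] := by funext i; fin_cases i; rfl
    rw [this, Fin.sum_univ_two, r0, r1]
    simp [h, sub_eq_add_neg]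
  have hint := setIntegral_omegaV_fderiv μ hD hfin hK hL u v
  have i1 : IntegrableOn (fun x => omegaV ![fderiv ℝ G x u, fderiv ℝ G x v]) D μ :=
    integrableOn_comp_fderiv μ hK hfin (continuous_omegaV_comp u v)
  have i2 : IntegrableOn (fun x => fderiv ℝ (h v) x u) D μ :=
    integrableOn_comp_fderiv_fderiv μ (hKh v) (hKh u) hfin (B := fun p => p.1 u) (by fun_prop)
  have i3 : IntegrableOn (fun x => fderiv ℝ (h u) x v) D μ :=
    integrableOn_comp_fderiv_fderiv μ (hKh v) (hKh u) hfin (B := fun p => p.2 v) (by fun_prop)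
  have hI := integral_congr_ae (μ := μ.restrict D) (Eventually.of_forall hpt)
  rw [integral_sub i1 (integrableOn_const hfin), integral_sub i2 i3,
    setIntegral_fderiv_apply μ hD hfin (hKh v) (hper v),
    setIntegral_fderiv_apply μ hD hfin (hKh u) (hper u), hint, setIntegral_const] at hI
  simp only [_root_.zero_apply, mul_zero, sub_zero, smul_eq_mul, ← mul_sub] at hI
  have hV : μ.real D ≠ 0 := by simp [Measure.real, ENNReal.toReal_eq_zero_iff, hfin, hpos]
  exact sub_eq_zero.1 ((mul_eq_zero.1 hI).resolve_left hV)

theorem ae_pullback_omegaV_eq (hD : IsAddFundamentalDomain Γ D μ) (hfin : μ D ≠ ⊤)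
    {F : ℍ → ℍ} {K : ℝ≥0} (hF : LipschitzWith K F) {L : ℍ →L[ℝ] ℍ}
    (hL : ∀ x, ∀ γ ∈ Γ, F (x + γ) = F x + L γ)
    (hω : ∀ u v, omegaV ![L u, L v] = omegaV ![u, v])
    (hmoment : ∀ᵐ x ∂μ, hyperMoment (fderiv ℝ F x) = 0) :
    ∀ᵐ x ∂μ.restrict D, omegaV.compContinuousLinearMap (fderiv ℝ F x) = omegaV := by
  have hframe : omegaV ![1, qi] = 1 := by
    rw [omegaV_apply]
    simp [qi]
  have hLdet : L.det = 1 := by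
    simp only [det_eq_pfaffian, hω, omegaV_apply]
    simp [qi, qj, qk]
  have i1 : IntegrableOn (fun x => (fderiv ℝ F x).det) D μ :=
    integrableOn_comp_fderiv μ hF hfin ContinuousLinearMap.continuous_det
  have i2 : IntegrableOn (fun x => 2 * omegaV ![fderiv ℝ F x 1, fderiv ℝ F x qi]) D μ :=
    integrableOn_comp_fderiv μ hF hfin
      (B := fun A => 2 * omegaV ![A 1, A qi]) (continuous_const.mul (continuous_omegaV_comp 1 qi))
  have i12 : IntegrableOn (fun x => (fderiv ℝ F x).det
      - 2 * omegaV ![fderiv ℝ F x 1, fderiv ℝ F x qi]) D μ := i1.sub i2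
  have i0 : IntegrableOn (fun _ : ℍ => (1 : ℝ)) D μ := integrableOn_const hfin
  have hint : ∫ x in D, ((fderiv ℝ F x).det
      - 2 * omegaV ![fderiv ℝ F x 1, fderiv ℝ F x qi] + 1) ∂μ = 0 := by
    rw [integral_add i12 i0, integral_sub i1 i2, integral_const_mul, setIntegral_const,
      setIntegral_det_fderiv μ hD hfin hF hL, setIntegral_omegaV_fderiv μ hD hfin hF hL, hLdet,
      hω, hframe, smul_eq_mul]
    ring
  have hnonneg : ∀ᵐ x ∂μ.restrict D, 0 ≤ (fderiv ℝ F x).det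
      - 2 * omegaV ![fderiv ℝ F x 1, fderiv ℝ F x qi] + 1 := by
    filter_upwards [ae_restrict_of_ae hmoment] with x hx
    obtain ⟨h1, h2, h3⟩ := (hyperMoment_eq_zero_iff _).1 hx
    rw [det_eq_pfaffian, h1, h2, h3]
    nlinarith [sq_nonneg (omegaV ![fderiv ℝ F x 1, fderiv ℝ F x qi] - 1),
      sq_nonneg (omegaV ![fderiv ℝ F x 1, fderiv ℝ F x qj]),
      sq_nonneg (omegaV ![fderiv ℝ F x 1, fderiv ℝ F x qk])]
  have hzero := (integral_eq_zero_iff_of_nonneg_ae hnonneg (i12.add i0)).1 hint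
  filter_upwards [hzero, ae_restrict_of_ae hmoment] with x hx hm
  exact pullback_omegaV_eq_of_hyperMoment_eq_zero hm hx

end MomentMap

end PolyTorus

end

/-! ### Conclusion: from almost everywhere to the whole of `M'`. -/

open MeasureTheory Filter Pointwise in
theorem mainTheorem8 (Γ : Submodule ℤ ℍ) [DiscreteTopology Γ] [IsZLattice ℝ Γ]
    (T : PolyTorus.EuclideanTriangulation Γ)
    (f : C(PolyTorus.Torus Γ, PolyTorus.Torus Γ)) (hf : PolyTorus.IsPolyhedral T f)
    (hclass : PolyTorus.PullbackClassEq Γ f (PolyTorus.omegaM Γ) (PolyTorus.omegaM Γ))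
    (hmoment : ∀ x ∉ T.skeleton 3, PolyTorus.hyperMoment (PolyTorus.torusDeriv Γ f x) = 0) :
    PolyTorus.IsSymplecticPolyhedral T f := by
  let _ : MeasurableSpace ℍ := borel ℍ
  have : BorelSpace ℍ := ⟨rfl⟩
  let μ : Measure ℍ := Measure.addHaar
  let b := Module.Free.chooseBasis ℤ Γ
  have hD := ZLattice.isAddFundamentalDomain b μ
  set D := ZSpan.fundamentalDomain (b.ofZLatticeBasis ℝ Γ)
  have hfin : μ D ≠ ⊤ := (ZSpan.fundamentalDomain_isBounded _).measure_lt_top.ne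
  have hpos : μ D ≠ 0 := ZSpan.measure_fundamentalDomain_ne_zero _
  obtain ⟨g, ⟨G, hG, hgG⟩, hfg, hcoh⟩ := hclass
  have hGlift : ∀ y, PolyTorus.proj Γ (G y) = g (PolyTorus.proj Γ y) := fun y => (hgG y).symm
  obtain ⟨L, hL⟩ := PolyTorus.exists_linear_periods hG.continuous hGlift
  have hω := PolyTorus.omegaV_periods_of_cohomologous μ hD hfin hpos hcoh hG hGlift hL
  obtain ⟨F, hF, hFlift, hFG⟩ := PolyTorus.exists_lift_of_homotopic hfg hG.continuous hGlift
  have hFL : ∀ x, ∀ γ ∈ Γ, F (x + γ) = F x + L γ := fun x γ hγ => by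
    rw [← sub_eq_iff_eq_add', hFG x γ hγ, hL x γ hγ, add_sub_cancel_left]
  obtain ⟨K, hK⟩ := hf.exists_lipschitzWith_lift hF hFlift
  have hskel : ∀ᵐ x ∂μ, PolyTorus.proj Γ x ∉ T.skeleton 3 :=
    compl_mem_ae_iff.2 (T.measure_preimage_skeleton μ)
  have hderiv : ∀ x, PolyTorus.proj Γ x ∉ T.skeleton 3 →
      PolyTorus.torusDeriv Γ f (PolyTorus.proj Γ x) = fderiv ℝ F x := fun x hx => by
    obtain ⟨A, hA⟩ := hf.exists_eventually_hasFDerivAt hF hFlift hx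
    exact PolyTorus.torusDeriv_proj hFlift hA.self_of_nhds.differentiableAt.hasFDerivAt
  have hae := PolyTorus.ae_pullback_omegaV_eq μ hD hfin hK hFL hω (by
    filter_upwards [hskel] with x hx
    rw [← hderiv x hx]
    exact hmoment _ hx)
  set N : Set ℍ := {x | PolyTorus.pullback Γ f (PolyTorus.omegaM Γ) (PolyTorus.proj Γ x)
    ≠ PolyTorus.omegaV} with hN
  -- The bad set `N` is `Γ`-invariant, so it is null as soon as it is null inside `D`.
  have hNinv : ∀ γ : Γ, γ +ᵥ N = N := by
    intro γ
    ext x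
    rw [Set.mem_vadd_set_iff_neg_vadd_mem, hN, Set.mem_ofPred_eq, Set.mem_ofPred_eq,
      show -γ +ᵥ x = x + (-γ : ℍ) from add_comm _ _, PolyTorus.proj_add (neg_mem γ.2)]
  have hND : μ (N ∩ D) = 0 := by
    have : ∀ᵐ x ∂μ.restrict D, x ∉ N := by
      filter_upwards [hae, ae_restrict_of_ae hskel] with x hx hs
      simpa [hN, PolyTorus.pullback, PolyTorus.omegaM, hderiv x hs] using hx
    rw [ae_iff, Measure.restrict_apply₀' hD.nullMeasurableSet] at this
    simpa using this
  have hN0 : μ N = 0 := by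
    have : VAddInvariantMeasure Γ ℍ μ := inferInstanceAs (VAddInvariantMeasure Γ.toAddSubgroup ℍ μ)
    have : MeasurableConstVAdd Γ ℍ := inferInstanceAs (MeasurableConstVAdd Γ.toAddSubgroup ℍ)
    exact hD.measure_zero_of_invariant N hNinv hND
  refine ⟨hf, fun y hy => ?_⟩
  obtain ⟨x, rfl⟩ := PolyTorus.proj_surjective y
  by_contra hne
  obtain ⟨A, hA⟩ := hf.exists_eventually_hasFDerivAt hF hFlift hy
  have hval : ∀ z, HasFDerivAt F A z →
      PolyTorus.pullback Γ f (PolyTorus.omegaM Γ) (PolyTorus.proj Γ z)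
        = PolyTorus.omegaV.compContinuousLinearMap A := fun z hz => by
    rw [PolyTorus.pullback, PolyTorus.torusDeriv_proj hFlift hz, PolyTorus.omegaM]
  -- The differential is constant near `x`, so one bad point off the skeleton would make a whole
  -- neighbourhood bad, contradicting `μ N = 0`.
  have hmem : N ∈ nhds x := by
    filter_upwards [hA] with z hz
    rw [hN, Set.mem_ofPred_eq, hval z hz, ← hval x hA.self_of_nhds]
    exact hne
  exact (μ.measure_pos_of_mem_nhds hmem).ne' hN0
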